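/- Let $n\ge 3$ and let $K\subset\mathbb{R}^n$ be a convex body, that is, a convex compact set with non-empty interior. Assume that $K$ is $1$-unconditional, i.e. $(x_1,\dots,x_n)\in K$ implies $(\epsilon_1x_1,\dots,\epsilon_nx_n)\in K$ for every choice of signs $\epsilon_i\in\{\pm1\}$, and that $K$ is cubelike, i.e. every extreme point $x$ of $K$ satisfies $x_i\neq 0$ for all $1\le i\le n$. A direction $d\in\mathbb{R}^n\setminus\{0\}$ illuminates a boundary point $x$ of $K$ if $x+\varepsilon d\in\operatorname{int}K$ for some $\varepsilon>0$; a set of directions is an illuminating set for $K$ if every boundary point of $K$ is illuminated by at least one of its members; and the illumination number $\mathfrak{I}(K)$ is the smallest cardinality of an illuminating set for $K$. If $K$ is not a parallelepiped, then $$\mathfrak{I}(K)\le 2^n-2.$$ Moreover, there is an illuminating set for $K$ of cardinality $2^n-2$ which consists of pairs of opposite directions (that is, which contains $-d$ whenever it contains $d$). -/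

import Mathlib

/-- A convex body in `ℝⁿ`: a convex compact set with non-empty interior. -/
structure IsConvexBody {n : ℕ} (K : Set (EuclideanSpace ℝ (Fin n))) : Prop where
  convex : Convex ℝ K
  isCompact : IsCompact K
  nonempty_interior : (interior K).Nonempty

/-- `K` is invariant under all coordinate reflections. -/
def IsOneUnconditional {n : ℕ} (K : Set (EuclideanSpace ℝ (Fin n))) : Prop :=
  ∀ x ∈ K, ∀ ε : Fin n → ℝ, (∀ i, ε i = 1 ∨ ε i = -1) →
    WithLp.toLp 2 (fun i => ε i * x i) ∈ K

/-- No extreme point of `K` lies on a coordinate hyperplane. -/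
def IsCubelike {n : ℕ} (K : Set (EuclideanSpace ℝ (Fin n))) : Prop :=
  ∀ x ∈ Set.extremePoints ℝ K, ∀ i, x i ≠ 0

/-- `K` is a (non-degenerate, arbitrarily placed) parallelepiped: a translate of the set of all
`∑ i, t i • b i`, `0 ≤ t i ≤ 1`, for some basis `b`. -/
def IsParallelepiped {n : ℕ} (K : Set (EuclideanSpace ℝ (Fin n))) : Prop :=
  ∃ (a : EuclideanSpace ℝ (Fin n)) (b : Module.Basis (Fin n) ℝ (EuclideanSpace ℝ (Fin n))),
    K = (fun x => a + x) '' parallelepiped b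

/-- The direction `d` illuminates the point `x` of `K`. -/
def Illuminates {n : ℕ} (K : Set (EuclideanSpace ℝ (Fin n))) (d x : EuclideanSpace ℝ (Fin n)) :
    Prop :=
  ∃ ε : ℝ, 0 < ε ∧ x + ε • d ∈ interior K

/-- `D` is a set of directions (non-zero vectors) such that every boundary point of `K` is
illuminated by a member of `D`. -/
def IsIlluminatingSet {n : ℕ} (K D : Set (EuclideanSpace ℝ (Fin n))) : Prop :=
  (∀ d ∈ D, d ≠ 0) ∧ ∀ x ∈ frontier K, ∃ d ∈ D, Illuminates K d x

/-- The smallest cardinality of an illuminating set for `K` (`⊤` if there is no finite one). -/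
noncomputable def illuminationNumber {n : ℕ} (K : Set (EuclideanSpace ℝ (Fin n))) : ℕ∞ :=
  ⨅ (D : Set (EuclideanSpace ℝ (Fin n))) (_ : IsIlluminatingSet K D), D.encard

/-! By Minkowski's theorem each point of `K` is a convex combination of extreme points. Since `K` is
cubelike, taking absolute values of those extreme points gives `p ∈ K` with all `p i > 0` and `|x i|
≤ p i` (`IsCubelike.exists_pos_abs_le`). Hence a direction without zero coordinates, pointing
against the signs of `x`, illuminates `x`, even where `x i = 0`; so one direction per orthant
suffices, `2 ^ n` in all.

Two of them can be saved when `K` is not a box. By compactness, every point of `K` then has some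
coordinate `i` at least a fixed `η` below its maximum over `K`. If the point lies in the positive
orthant, it may move slightly outwards in coordinate `i` while the others decrease
(`illuminates_of_add_le`). That direction already serves the orthant whose only negative sign is at
`i`, so the positive orthant needs none of its own; by symmetry neither does the negative one. -/

open Set Filter Topology

/-! ### Minkowski's theorem on extreme points -/

section Minkowski

variable {E : Type*} [AddCommGroup E] [Module ℝ E]

/-- The vectors along which one can move from `y` both forwards and backwards inside the convex
set `K`. -/
def twoSidedDirections {K : Set E} (hK : Convex ℝ K) {y : E} (hy : y ∈ K) : Submodule ℝ E where
  carrier := {w | ∃ s : ℝ, 0 < s ∧ y + s • w ∈ K ∧ y - s • w ∈ K}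
  zero_mem' := ⟨1, one_pos, by simpa using hy, by simpa using hy⟩
  add_mem' := by
    rintro v w ⟨s, hs, h1, h2⟩ ⟨t, ht, h3, h4⟩
    have hst : s + t ≠ 0 := by positivity
    have hsum : t / (s + t) + s / (s + t) = 1 := by field_simp; ring
    -- The weights are chosen so that `s • v` and `t • w` get the same coefficient.
    refine ⟨s * t / (s + t), by positivity, ?_, ?_⟩
    · convert hK h1 h3 (by positivity : 0 ≤ t / (s + t)) (by positivity : 0 ≤ s / (s + t)) hsum
        using 1
      have : y = (t / (s + t) + s / (s + t)) • y := by rw [hsum, one_smul]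
      nth_rewrite 1 [this]
      module
    · convert hK h2 h4 (by positivity : 0 ≤ t / (s + t)) (by positivity : 0 ≤ s / (s + t)) hsum
        using 1
      have : y = (t / (s + t) + s / (s + t)) • y := by rw [hsum, one_smul]
      nth_rewrite 1 [this]
      module
  smul_mem' := by
    rintro c w ⟨s, hs, h1, h2⟩
    rcases lt_trichotomy c 0 with hc | rfl | hc
    · refine ⟨s / -c, div_pos hs (neg_pos.2 hc), ?_, ?_⟩
      · convert h2 using 1
        rw [smul_smul, div_neg, neg_mul, div_mul_cancel₀ _ hc.ne, neg_smul, sub_eq_add_neg]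
      · convert h1 using 1
        rw [smul_smul, div_neg, neg_mul, div_mul_cancel₀ _ hc.ne, neg_smul, sub_neg_eq_add]
    · exact ⟨1, one_pos, by simpa using hy, by simpa using hy⟩
    · refine ⟨s / c, div_pos hs hc, ?_, ?_⟩
      · rwa [smul_smul, div_mul_cancel₀ _ hc.ne']
      · rwa [smul_smul, div_mul_cancel₀ _ hc.ne']

theorem mem_extremePoints_of_twoSidedDirections_eq_bot {K : Set E} (hK : Convex ℝ K) {y : E}
    (hy : y ∈ K) (h : twoSidedDirections hK hy = ⊥) : y ∈ extremePoints ℝ K := by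
  rw [mem_extremePoints_iff_left]
  refine ⟨hy, ?_⟩
  rintro u hu v hv ⟨a, b, ha, hb, hab, rfl⟩
  have hb' : b = 1 - a := by linarith
  have hmin : 0 < min a b := lt_min ha hb
  have hmem : u - v ∈ twoSidedDirections hK hy := by
    -- Shifting weight `min a b` between `u` and `v` keeps both weights nonnegative.
    refine ⟨min a b, hmin, ?_, ?_⟩
    · convert hK hu hv (by positivity : 0 ≤ a + min a b)
        (by linarith [min_le_right a b] : 0 ≤ b - min a b) (by linarith) using 1
      module
    · convert hK hu hv (by linarith [min_le_left a b] : 0 ≤ a - min a b)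
        (by positivity : 0 ≤ b + min a b) (by linarith) using 1
      module
  rw [h, Submodule.mem_bot, sub_eq_zero] at hmem
  rw [← hmem, ← add_smul, hab, one_smul]

/-- The homothety with centre `v` and ratio `a > 0` sends `u` to `y` and segments of `K` around `u`
to segments of `K` around `y`. -/
theorem twoSidedDirections_le {K : Set E} (hK : Convex ℝ K) {u v y : E} (hu : u ∈ K) (hv : v ∈ K)
    (hy : y ∈ K) {a b : ℝ} (ha : 0 < a) (hb : 0 ≤ b) (hab : a + b = 1) (h : a • u + b • v = y) :
    twoSidedDirections hK hu ≤ twoSidedDirections hK hy := by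
  rintro w ⟨s, hs, h1, h2⟩
  refine ⟨a * s, by positivity, ?_, ?_⟩
  · convert hK h1 hv ha.le hb hab using 1
    rw [← h]
    module
  · convert hK h2 hv ha.le hb hab using 1
    rw [← h]
    module

/-- **Minkowski's theorem**: in finite dimension, a compact convex set is the convex hull of its
extreme points, without taking the closure. -/
theorem subset_convexHull_extremePoints [TopologicalSpace E] [T2Space E] [IsTopologicalAddGroup E]
    [ContinuousSMul ℝ E] [FiniteDimensional ℝ E] {K : Set E} (hK : Convex ℝ K)
    (hcomp : IsCompact K) : K ⊆ convexHull ℝ (extremePoints ℝ K) := by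
  suffices H : ∀ k : ℕ, ∀ (y : E) (hy : y ∈ K),
      Module.finrank ℝ (twoSidedDirections hK hy) = k → y ∈ convexHull ℝ (extremePoints ℝ K) from
    fun y hy => H _ y hy rfl
  intro k
  induction k using Nat.strong_induction_on with
  | _ k ih =>
  intro y hy hk
  by_cases hbot : twoSidedDirections hK hy = ⊥
  · exact subset_convexHull ℝ _ (mem_extremePoints_of_twoSidedDirections_eq_bot hK hy hbot)
  obtain ⟨w, hw, hw0⟩ := Submodule.exists_mem_ne_zero_of_ne_bot hbot
  obtain ⟨s, hs, h1, h2⟩ := hw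
  have hemb : IsClosedEmbedding fun t : ℝ => y + t • w :=
    (Homeomorph.addLeft y).isClosedEmbedding.comp (isClosedEmbedding_smul_left hw0)
  have hS : IsCompact ((fun t : ℝ => y + t • w) ⁻¹' K) := hemb.isCompact_preimage hcomp
  have hne : ((fun t : ℝ => y + t • w) ⁻¹' K).Nonempty := ⟨s, h1⟩
  obtain ⟨p, hp, hpmax⟩ := hS.exists_isGreatest hne
  obtain ⟨m, hm, hmmin⟩ := hS.exists_isLeast hne
  have hps : s ≤ p := hpmax h1
  have hms : m ≤ -s := hmmin (by
    change y + (-s) • w ∈ K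
    rwa [neg_smul, ← sub_eq_add_neg])
  have hpm : 0 < p - m := by linarith
  have hpK : y + p • w ∈ K := hp
  have hmK : y + m • w ∈ K := hm
  have hcomb : (-m / (p - m)) • (y + p • w) + (p / (p - m)) • (y + m • w) = y := by
    have e1 : -m / (p - m) + p / (p - m) = 1 := by field_simp; ring
    have e2 : -m / (p - m) * p + p / (p - m) * m = 0 := by field_simp; ring
    calc _ = (-m / (p - m) + p / (p - m)) • y
          + (-m / (p - m) * p + p / (p - m) * m) • w := by module
      _ = y := by rw [e1, e2, one_smul, zero_smul, add_zero]
  have hm' : 0 < -m / (p - m) := div_pos (by linarith) hpm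
  have hp' : 0 < p / (p - m) := div_pos (by linarith) hpm
  have hsum : -m / (p - m) + p / (p - m) = 1 := by field_simp; ring
  have hpw : w ∉ twoSidedDirections hK hpK := by
    rintro ⟨t, ht, h3, -⟩
    have : p + t ≤ p := hpmax (by
      change y + (p + t) • w ∈ K
      rwa [add_smul, ← add_assoc])
    linarith
  have hmw : w ∉ twoSidedDirections hK hmK := by
    rintro ⟨t, ht, -, h3⟩
    have : m ≤ m - t := hmmin (by
      change y + (m - t) • w ∈ K
      rwa [sub_smul, ← add_sub_assoc])
    linarith
  have hwy : w ∈ twoSidedDirections hK hy := ⟨s, hs, h1, h2⟩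
  -- At both ends of the chord through `y` the direction `w` is lost and none is gained, so the
  -- dimension drops.
  have key : ∀ (u : E) (hu : u ∈ K), twoSidedDirections hK hu ≤ twoSidedDirections hK hy →
      w ∉ twoSidedDirections hK hu → u ∈ convexHull ℝ (extremePoints ℝ K) := by
    intro u hu hle hwu
    refine ih _ ?_ u hu rfl
    rw [← hk]
    exact Submodule.finrank_lt_finrank_of_lt (lt_of_le_of_ne hle fun h => hwu (h ▸ hwy))
  have hp2 := key _ hpK (twoSidedDirections_le hK hpK hmK hy hm' hp'.le hsum hcomb) hpw
  have hm2 := key _ hmK (twoSidedDirections_le hK hmK hpK hy hp' hm'.le (by linarith)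
    (by rw [add_comm, hcomb])) hmw
  rw [← hcomb]
  exact convex_convexHull ℝ _ hp2 hm2 hm'.le hp'.le hsum

end Minkowski

/-! ### Unconditional and cubelike bodies -/

section Unconditional

variable {n : ℕ} {K : Set (EuclideanSpace ℝ (Fin n))}

theorem IsOneUnconditional.abs_mem (hunc : IsOneUnconditional K) {x : EuclideanSpace ℝ (Fin n)}
    (hx : x ∈ K) : WithLp.toLp 2 (fun i => |x i|) ∈ K := by
  have h := hunc x hx (fun i => if 0 ≤ x i then 1 else -1) (fun i => by
    by_cases h : 0 ≤ x i <;> simp [h])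
  convert h using 3 with i
  by_cases hi : 0 ≤ x i
  · simp [hi, abs_of_nonneg hi]
  · simp [hi, abs_of_neg (not_le.1 hi)]

theorem IsOneUnconditional.neg_mem (hunc : IsOneUnconditional K) {x : EuclideanSpace ℝ (Fin n)}
    (hx : x ∈ K) : -x ∈ K := by
  convert hunc x hx (fun _ => -1) (fun _ => Or.inr rfl) using 1
  ext i
  simp

/-- A convex unconditional set contains the coordinate box spanned by each of its points. -/
theorem IsOneUnconditional.mem_of_abs_le (hunc : IsOneUnconditional K) (hK : Convex ℝ K)
    {p y : EuclideanSpace ℝ (Fin n)} (hp : p ∈ K) (hy : ∀ i, |y i| ≤ |p i|) : y ∈ K := by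
  -- Coordinates are changed from `p` to `y` one at a time: `y` lies between `u` and its reflection
  -- in coordinate `k`.
  suffices H : ∀ (s : Finset (Fin n)) (y : EuclideanSpace ℝ (Fin n)), (∀ i, |y i| ≤ |p i|) →
      (∀ i ∉ s, y i = p i) → y ∈ K from H Finset.univ y hy (by simp)
  intro s
  induction s using Finset.induction_on with
  | empty =>
    intro y _ h
    have : y = p := by ext i; exact h i (by simp)
    rwa [this]
  | insert k s hk ih =>
    intro y hy h
    let u : EuclideanSpace ℝ (Fin n) := WithLp.toLp 2 fun i => if i = k then p k else y i
    have hu : u ∈ K := by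
      refine ih u (fun i => ?_) fun i hi => ?_
      · by_cases hik : i = k
        · subst hik; simp [u]
        · simpa [u, hik] using hy i
      · by_cases hik : i = k
        · subst hik; simp [u]
        · simpa [u, hik] using h i (by simp [hik, hi])
    have hv := hunc u hu (fun i => if i = k then -1 else 1) fun i => by
      by_cases h : i = k <;> simp [h]
    by_cases hpk : p k = 0
    · have hyk : y k = 0 := by simpa [hpk] using hy k
      convert hu using 1
      ext i
      by_cases hik : i = k
      · subst hik; simp [u, hpk, hyk]
      · simp [u, hik]
    have hr : |y k / p k| ≤ 1 := by
      rw [abs_div]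
      exact div_le_one_of_le₀ (hy k) (abs_nonneg _)
    rw [abs_le] at hr
    convert hK hu hv (by linarith [hr.1] : 0 ≤ (1 + y k / p k) / 2)
      (by linarith [hr.2] : 0 ≤ (1 - y k / p k) / 2) (by ring) using 1
    ext i
    by_cases hik : i = k
    · subst hik
      simp [u]
      field_simp
      ring
    · simp [u, hik]
      ring

theorem IsOneUnconditional.mem_interior_of_abs_lt (hunc : IsOneUnconditional K)
    (hK : Convex ℝ K) {p y : EuclideanSpace ℝ (Fin n)} (hp : p ∈ K) (hy : ∀ i, |y i| < |p i|) :
    y ∈ interior K := by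
  refine mem_interior.2 ⟨{z | ∀ i, |z i| < |p i|},
    fun z hz => hunc.mem_of_abs_le hK hp fun i => (hz i).le, ?_, hy⟩
  rw [ofPred_forall]
  exact isOpen_iInter_of_finite fun i => isOpen_lt (by fun_prop) continuous_const

/-- In a cubelike unconditional convex body every point is dominated by one with positive
coordinates. -/
theorem IsCubelike.exists_pos_abs_le (hcube : IsCubelike K) (hunc : IsOneUnconditional K)
    (hK : IsConvexBody K) {x : EuclideanSpace ℝ (Fin n)} (hx : x ∈ K) :
    ∃ p ∈ K, ∀ i, 0 < p i ∧ |x i| ≤ p i := by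
  have hconv : Convex ℝ {x : EuclideanSpace ℝ (Fin n) | ∃ p ∈ K, ∀ i, 0 < p i ∧ |x i| ≤ p i} := by
    rintro u ⟨p, hp, hup⟩ v ⟨q, hq, hvq⟩ a b ha hb hab
    refine ⟨a • p + b • q, hK.convex hp hq ha hb hab, fun i => ⟨?_, ?_⟩⟩
    · have := (hup i).1
      have := (hvq i).1
      rcases ha.eq_or_lt with rfl | ha'
      · have : b = 1 := by linarith
        simp [this, (hvq i).1]
      · simp only [PiLp.add_apply, PiLp.smul_apply, smul_eq_mul]
        positivity
    · simp only [PiLp.add_apply, PiLp.smul_apply, smul_eq_mul]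
      calc |a * u i + b * v i| ≤ |a * u i| + |b * v i| := abs_add_le _ _
        _ = a * |u i| + b * |v i| := by rw [abs_mul, abs_mul, abs_of_nonneg ha, abs_of_nonneg hb]
        _ ≤ a * p i + b * q i := by gcongr; exacts [(hup i).2, (hvq i).2]
  have hext : extremePoints ℝ K ⊆
      {x : EuclideanSpace ℝ (Fin n) | ∃ p ∈ K, ∀ i, 0 < p i ∧ |x i| ≤ p i} := fun e he =>
    ⟨_, hunc.abs_mem he.1, fun i => ⟨abs_pos.2 (hcube e he i), le_rfl⟩⟩
  exact convexHull_min hext hconv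
    (subset_convexHull_extremePoints hK.convex hK.isCompact hx)

/-- One corner suffices, since `K` contains the box spanned by it. The edges are `2 * a i` along the
axes, starting at `-a`. -/
theorem isParallelepiped_of_corner_mem (hunc : IsOneUnconditional K) (hK : Convex ℝ K)
    {a : Fin n → ℝ} (ha : ∀ i, 0 < a i) (hle : ∀ x ∈ K, ∀ i, |x i| ≤ a i)
    {c : EuclideanSpace ℝ (Fin n)} (hc : c ∈ K) (hca : ∀ i, |c i| = a i) :
    IsParallelepiped K := by
  let b : Module.Basis (Fin n) ℝ (EuclideanSpace ℝ (Fin n)) :=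
    (EuclideanSpace.basisFun (Fin n) ℝ).toBasis.isUnitSMul
      (fun i => (show IsUnit (2 * a i) from IsUnit.mk0 _ (by linarith [ha i] : 0 < 2 * a i).ne'))
  have hb : ∀ i, b i = (2 * a i) • EuclideanSpace.single i (1 : ℝ) := fun i => by
    simp [b, Module.Basis.isUnitSMul_apply]
  have hsum : ∀ (t : Fin n → ℝ) (j : Fin n), (∑ i, t i • b i) j = t j * (2 * a j) := by
    intro t j
    simp [hb, Finset.sum_apply, Pi.single_apply]
  refine ⟨-WithLp.toLp 2 a, b, ?_⟩
  ext x
  simp only [mem_image, mem_parallelepiped_iff]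
  constructor
  · intro hx
    refine ⟨x + WithLp.toLp 2 a, ⟨fun i => (x i + a i) / (2 * a i), ?_, ?_⟩, by simp⟩
    · constructor
      · intro i
        have := abs_le.1 (hle x hx i)
        exact div_nonneg (by linarith) (by linarith [ha i])
      · intro i
        have := abs_le.1 (hle x hx i)
        exact div_le_one_of_le₀ (by linarith) (by linarith [ha i])
    · ext j
      rw [hsum, div_mul_cancel₀ _ (by linarith [ha j] : 0 < 2 * a j).ne']
      simp
  · rintro ⟨_, ⟨t, ⟨ht0, ht1⟩, rfl⟩, rfl⟩
    refine hunc.mem_of_abs_le hK hc fun i => ?_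
    have h0 : 0 ≤ t i := ht0 i
    have h1 : t i ≤ 1 := ht1 i
    rw [hca, PiLp.add_apply, hsum, abs_le]
    simp only [PiLp.neg_apply]
    constructor <;> nlinarith [ha i]

/-- A compact unconditional convex body other than a box stays away from the corners of its
circumscribed box. -/
theorem exists_gap_of_not_isParallelepiped (hunc : IsOneUnconditional K) (hK : IsConvexBody K)
    (hpar : ¬ IsParallelepiped K) {a : Fin n → ℝ} (ha : ∀ i, 0 < a i)
    (hle : ∀ x ∈ K, ∀ i, |x i| ≤ a i) :
    ∃ η : ℝ, 0 < η ∧ ∀ x ∈ K, ∃ i, |x i| + η ≤ a i := by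
  obtain ⟨c, hc, hmin⟩ := hK.isCompact.exists_isMinOn (hK.nonempty_interior.mono interior_subset)
    (f := fun x : EuclideanSpace ℝ (Fin n) => ∑ i, (a i - |x i|)) (by fun_prop)
  have hnn : ∀ x ∈ K, ∀ i ∈ Finset.univ, 0 ≤ a i - |x i| := fun x hx i _ =>
    sub_nonneg.2 (hle x hx i)
  have hpos : 0 < ∑ i, (a i - |c i|) := by
    refine lt_of_le_of_ne (Finset.sum_nonneg (hnn c hc)) fun h0 => hpar ?_
    have h := (Finset.sum_eq_zero_iff_of_nonneg (hnn c hc)).1 h0.symm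
    exact isParallelepiped_of_corner_mem hunc hK.convex ha hle hc fun i => by
      linarith [h i (Finset.mem_univ i)]
  have hn : 0 < (n : ℝ) := by
    rcases Nat.eq_zero_or_pos n with rfl | h
    · simp at hpos
    · exact_mod_cast h
  -- `η` is the mean deficit at the minimiser `c`; if all deficits at `x` were smaller, their sum
  -- would be below the minimum.
  refine ⟨(∑ i, (a i - |c i|)) / n, by positivity, fun x hx => ?_⟩
  by_contra! h
  have h1 : ∑ i, (a i - |x i|) < ∑ _i : Fin n, (∑ i, (a i - |c i|)) / n := by
    refine Finset.sum_lt_sum_of_nonempty ?_ fun i _ => by linarith [h i]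
    exact ⟨⟨0, by exact_mod_cast hn⟩, Finset.mem_univ _⟩
  have h2 : ∑ i, (a i - |c i|) ≤ ∑ i, (a i - |x i|) := hmin hx
  rw [Finset.sum_const, Finset.card_univ, Fintype.card_fin, nsmul_eq_mul,
    mul_div_cancel₀ _ hn.ne'] at h1
  linarith

end Unconditional

/-! ### Two criteria for illumination -/

section Illumination

variable {n : ℕ} {K : Set (EuclideanSpace ℝ (Fin n))}

theorem Illuminates.neg (hunc : IsOneUnconditional K) {d x : EuclideanSpace ℝ (Fin n)}
    (h : Illuminates K d x) : Illuminates K (-d) (-x) := by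
  obtain ⟨ε, hε, h⟩ := h
  have hK : Homeomorph.neg (EuclideanSpace ℝ (Fin n)) ⁻¹' K = K := by
    ext y
    exact ⟨fun hy => by simpa using hunc.neg_mem hy, fun hy => hunc.neg_mem hy⟩
  refine ⟨ε, hε, ?_⟩
  rw [← hK, ← Homeomorph.preimage_interior]
  change -(-x + ε • -d) ∈ interior K
  convert h using 1
  module

/-- A direction whose signs are opposite to those of `x` illuminates `x`. -/
theorem illuminates_of_mul_nonpos (hcube : IsCubelike K) (hunc : IsOneUnconditional K)
    (hK : IsConvexBody K) {d x : EuclideanSpace ℝ (Fin n)} (hx : x ∈ K) (hd : ∀ i, d i ≠ 0)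
    (hdx : ∀ i, d i * x i ≤ 0) : Illuminates K d x := by
  obtain ⟨p, hp, hpx⟩ := hcube.exists_pos_abs_le hunc hK hx
  have hev : ∀ᶠ ε : ℝ in 𝓝[>] 0, ∀ i, |x i + ε * d i| < |p i| := by
    rw [eventually_all]
    intro i
    rw [abs_of_pos (hpx i).1]
    by_cases hxi : x i = 0
    · refine Filter.Eventually.filter_mono nhdsWithin_le_nhds ?_
      have hc : ContinuousAt (fun ε : ℝ => |x i + ε * d i|) 0 := by fun_prop
      exact hc.eventually_lt continuousAt_const (by simp [hxi, (hpx i).1])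
    · have hneg : d i * x i < 0 := lt_of_le_of_ne (hdx i) (mul_ne_zero (hd i) hxi)
      -- This is `((x i + ε * d i) ^ 2 - x i ^ 2) / ε`, negative for small `ε > 0`.
      have hc : ContinuousAt (fun ε : ℝ => 2 * (d i * x i) + ε * d i ^ 2) 0 := by fun_prop
      have h1 := Filter.Eventually.filter_mono (nhdsWithin_le_nhds (s := Ioi 0))
        (hc.eventually_lt (continuousAt_const (y := (0 : ℝ))) (by
          rw [zero_mul, add_zero]
          linarith))
      filter_upwards [h1, self_mem_nhdsWithin] with ε h1 hε
      have hε : 0 < ε := hε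
      refine lt_of_lt_of_le (sq_lt_sq.1 ?_) (hpx i).2
      nlinarith [mul_neg_of_pos_of_neg hε h1]
  obtain ⟨ε, h, hε⟩ := (hev.and self_mem_nhdsWithin).exists
  exact ⟨ε, hε, hunc.mem_interior_of_abs_lt hK.convex hp (by simpa using h)⟩

/-- A direction pointing slightly outwards in one coordinate illuminates those points of the
positive orthant whose coordinate in question is not too close to its maximum. -/
theorem illuminates_of_add_le (hcube : IsCubelike K) (hunc : IsOneUnconditional K)
    (hK : IsConvexBody K) {d x q : EuclideanSpace ℝ (Fin n)} (hx : x ∈ K) (hx0 : ∀ j, 0 ≤ x j)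
    (hq : q ∈ K) (hq0 : ∀ j, 0 ≤ q j) {A η : ℝ} (hA : 0 < A) (hxA : ∀ j, x j < A) (hη : 0 < η)
    {i : Fin n} (hi : x i + η ≤ q i) (hdi : d i = η / (2 * A)) (hd : ∀ j ≠ i, d j = -1) :
    Illuminates K d x := by
  obtain ⟨p, hp, hpx⟩ := hcube.exists_pos_abs_le hunc hK hx
  have hev : ∀ᶠ t : ℝ in 𝓝[>] 0, ∀ j, t * A - x j < (1 - t) * p j := by
    rw [eventually_all]
    intro j
    refine Filter.Eventually.filter_mono nhdsWithin_le_nhds ?_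
    have h1 : ContinuousAt (fun t : ℝ => t * A - x j) 0 := by fun_prop
    have h2 : ContinuousAt (fun t : ℝ => (1 - t) * p j) 0 := by fun_prop
    exact h1.eventually_lt h2 (by simp; linarith [hx0 j, (hpx j).1])
  have hlt : ∀ᶠ t : ℝ in 𝓝[>] 0, t < 1 :=
    Filter.Eventually.filter_mono nhdsWithin_le_nhds (eventually_lt_nhds one_pos)
  obtain ⟨t, ⟨h, ht1⟩, ht⟩ := ((hev.and hlt).and self_mem_nhdsWithin).exists
  have ht : 0 < t := ht
  -- The comparison point is `(1 - t) • p + t • q`: `q` gains at least `t * η` in coordinate `i`, of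
  -- which the move uses half; elsewhere a decrease by `t * A` exceeds the loss `t * x j`.
  refine ⟨t * A, by positivity, hunc.mem_interior_of_abs_lt hK.convex
    (hK.convex hp hq (by linarith : 0 ≤ 1 - t) ht.le (by ring)) fun j => ?_⟩
  have hxp : x j ≤ p j := (le_abs_self _).trans (hpx j).2
  have hmul : (1 - t) * x j ≤ (1 - t) * p j := mul_le_mul_of_nonneg_left hxp (by linarith)
  have htq : 0 ≤ t * q j := mul_nonneg ht.le (hq0 j)
  have htx : t * x j < t * A := mul_lt_mul_of_pos_left (hxA j) ht
  refine lt_of_lt_of_le ?_ (le_abs_self _)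
  simp only [PiLp.add_apply, PiLp.smul_apply, smul_eq_mul]
  by_cases hj : j = i
  · subst hj
    have e : t * A * d j = t * η / 2 := by rw [hdi]; field_simp
    have htη : 0 < t * η := by positivity
    have hqt : t * (x j + η) ≤ t * q j := mul_le_mul_of_nonneg_left hi ht.le
    rw [e, abs_of_nonneg (by linarith [hx0 j])]
    linarith
  · rw [hd j hj, abs_lt]
    constructor <;> linarith [h j]

end Illumination

/-! ### The directions attached to orthants -/

section Directions

variable {n : ℕ}

/-- The direction attached to the orthant `v` (`true` stands for nonnegative coordinates): it
points against the signs of `v`, but is short in a coordinate whose sign differs from all the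
others. -/
def orthantDirection (δ : ℝ) (v : Fin n → Bool) : EuclideanSpace ℝ (Fin n) :=
  WithLp.toLp 2 fun j => (if v j then -1 else 1) * (if ∀ k ≠ j, v k ≠ v j then δ else 1)

theorem orthantDirection_not (δ : ℝ) (v : Fin n → Bool) :
    orthantDirection δ (fun j => !v j) = -orthantDirection δ v := by
  ext j
  simp only [orthantDirection, PiLp.neg_apply, ne_eq, Bool.not_inj_iff]
  cases v j <;> simp only [Bool.not_true, Bool.not_false] <;>
    simp only [↓reduceIte, Bool.false_eq_true] <;> ring

theorem orthantDirection_apply_of_true {δ : ℝ} (hδ : 0 < δ) {v : Fin n → Bool} {j : Fin n}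
    (h : v j = true) : orthantDirection δ v j < 0 := by
  simp only [orthantDirection, h]
  split_ifs <;> simp_all

theorem orthantDirection_apply_of_false {δ : ℝ} (hδ : 0 < δ) {v : Fin n → Bool} {j : Fin n}
    (h : v j = false) : 0 < orthantDirection δ v j := by
  simp only [orthantDirection, h]
  split_ifs <;> simp_all

theorem orthantDirection_injective {δ : ℝ} (hδ : 0 < δ) :
    Function.Injective (orthantDirection (n := n) δ) := by
  intro v w h
  ext j
  have hj : orthantDirection δ v j = orthantDirection δ w j := by rw [h]
  cases hv : v j <;> cases hw : w j <;> try rfl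
  · linarith [orthantDirection_apply_of_false hδ hv, orthantDirection_apply_of_true hδ hw]
  · linarith [orthantDirection_apply_of_true hδ hv, orthantDirection_apply_of_false hδ hw]

theorem orthantDirection_apply_ne_zero {δ : ℝ} (hδ : 0 < δ) (v : Fin n → Bool) (j : Fin n) :
    orthantDirection δ v j ≠ 0 := by
  cases hv : v j
  · exact (orthantDirection_apply_of_false hδ hv).ne'
  · exact (orthantDirection_apply_of_true hδ hv).ne

theorem orthantDirection_flip_same (δ : ℝ) (i : Fin n) :
    orthantDirection δ (fun j => decide (j ≠ i)) i = δ := by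
  simp [orthantDirection]

/-- A third index `k` shares the sign of `j`, so `j` is not the odd one out; with `n = 2` both
coordinates would be short. -/
theorem orthantDirection_flip_of_ne (hn : 3 ≤ n) (δ : ℝ) {i j : Fin n} (hj : j ≠ i) :
    orthantDirection δ (fun j => decide (j ≠ i)) j = -1 := by
  obtain ⟨k, hk⟩ : ∃ k, k ∉ ({i, j} : Finset (Fin n)) := by
    by_contra! h
    have h1 : (Finset.univ : Finset (Fin n)) ⊆ {i, j} := fun k _ => h k
    have h2 := (Finset.card_le_card h1).trans Finset.card_le_two
    simp at h2
    omega
  simp only [Finset.mem_insert, Finset.mem_singleton, not_or] at hk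
  have : ¬ ∀ k ≠ j, decide (k ≠ i) ≠ decide (j ≠ i) := fun h => h k hk.2 (by simp [hk.1, hj])
  simp only [orthantDirection]
  rw [if_neg this]
  simp [hj]

/-- The directions attached to all orthants but the positive and the negative one. -/
noncomputable def mixedDirections (n : ℕ) (δ : ℝ) : Finset (EuclideanSpace ℝ (Fin n)) :=
  open Classical in
  ((Finset.univ \ {fun _ => true, fun _ => false} : Finset (Fin n → Bool))).image
    (orthantDirection δ)

theorem mem_mixedDirections {δ : ℝ} {d : EuclideanSpace ℝ (Fin n)} :
    d ∈ mixedDirections n δ ↔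
      ∃ v, (v ≠ (fun _ => true) ∧ v ≠ fun _ => false) ∧ orthantDirection δ v = d := by
  simp [mixedDirections]

theorem card_mixedDirections (hn : 0 < n) {δ : ℝ} (hδ : 0 < δ) :
    (mixedDirections n δ).card = 2 ^ n - 2 := by
  have hne : (fun _ : Fin n => true) ≠ fun _ => false := fun h => by
    simpa using congrFun h ⟨0, hn⟩
  rw [mixedDirections, Finset.card_image_of_injective _ (orthantDirection_injective hδ),
    Finset.card_sdiff_of_subset (Finset.subset_univ _), Finset.card_pair hne]
  simp

theorem neg_mem_mixedDirections {δ : ℝ} {d : EuclideanSpace ℝ (Fin n)}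
    (hd : d ∈ mixedDirections n δ) : -d ∈ mixedDirections n δ := by
  rw [mem_mixedDirections] at hd ⊢
  obtain ⟨v, ⟨h1, h2⟩, rfl⟩ := hd
  refine ⟨fun j => !v j, ⟨fun h => h2 ?_, fun h => h1 ?_⟩, orthantDirection_not δ v⟩
  · funext j
    simpa using congrFun h j
  · funext j
    simpa using congrFun h j

theorem orthantDirection_flip_mem_mixedDirections (hn : 2 ≤ n) (δ : ℝ) (i : Fin n) :
    orthantDirection δ (fun j => decide (j ≠ i)) ∈ mixedDirections n δ := by
  refine mem_mixedDirections.2 ⟨_, ⟨fun h => ?_, fun h => ?_⟩, rfl⟩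
  · simpa using congrFun h i
  · have : Nontrivial (Fin n) := Fin.nontrivial_iff_two_le.2 hn
    obtain ⟨j, hj⟩ := exists_ne i
    have := congrFun h j
    simp [hj] at this

theorem exists_isIlluminatingSet_mixedDirections (hn : 3 ≤ n)
    {K : Set (EuclideanSpace ℝ (Fin n))} (hK : IsConvexBody K) (hunc : IsOneUnconditional K)
    (hcube : IsCubelike K) (hpar : ¬ IsParallelepiped K) :
    ∃ δ : ℝ, 0 < δ ∧
      IsIlluminatingSet K (mixedDirections n δ : Set (EuclideanSpace ℝ (Fin n))) := by
  have hne : K.Nonempty := hK.nonempty_interior.mono interior_subset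
  have hmax : ∀ i : Fin n, ∃ q ∈ K, (∀ j, 0 ≤ q j) ∧ ∀ x ∈ K, |x i| ≤ q i := by
    intro i
    obtain ⟨q, hq, hmax⟩ := hK.isCompact.exists_isMaxOn hne
      (f := fun x : EuclideanSpace ℝ (Fin n) => |x i|) (by fun_prop)
    exact ⟨_, hunc.abs_mem hq, fun j => abs_nonneg _, fun x hx => hmax hx⟩
  choose q hqK hq0 hq using hmax
  have hqpos : ∀ i, 0 < q i i := fun i => by
    obtain ⟨x, hx⟩ := hne
    obtain ⟨p, hp, hpx⟩ := hcube.exists_pos_abs_le hunc hK hx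
    exact (hpx i).1.trans_le ((le_abs_self _).trans (hq i p hp))
  obtain ⟨η, hη, hgap⟩ := exists_gap_of_not_isParallelepiped hunc hK hpar hqpos
    fun x hx i => hq i x hx
  obtain ⟨A, hA, hxA⟩ : ∃ A : ℝ, 0 < A ∧ ∀ x ∈ K, ∀ j, x j < A := by
    refine ⟨∑ i, q i i + 1, ?_, fun x hx j => ?_⟩
    · have := Finset.sum_nonneg fun i (_ : i ∈ Finset.univ) => (hqpos i).le
      linarith
    · have := Finset.single_le_sum (f := fun i => q i i) (fun i _ => (hqpos i).le)
        (Finset.mem_univ j)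
      linarith [(le_abs_self _).trans (hq j x hx)]
  have hδ : 0 < η / (2 * A) := by positivity
  have hposorthant : ∀ x ∈ K, (∀ j, 0 ≤ x j) →
      ∃ d ∈ mixedDirections n (η / (2 * A)), Illuminates K d x := by
    intro x hx hx0
    obtain ⟨i, hi⟩ := hgap x hx
    rw [abs_of_nonneg (hx0 i)] at hi
    exact ⟨_, orthantDirection_flip_mem_mixedDirections (by omega) _ i,
      illuminates_of_add_le hcube hunc hK hx hx0 (hqK i) (hq0 i) hA (hxA x hx) hη hi
        (orthantDirection_flip_same _ i) fun j hj => orthantDirection_flip_of_ne hn _ hj⟩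
  refine ⟨η / (2 * A), hδ, fun d hd => ?_, fun x hx => ?_⟩
  · obtain ⟨v, -, rfl⟩ := mem_mixedDirections.1 hd
    intro h
    exact orthantDirection_apply_ne_zero hδ v ⟨0, by omega⟩ (by rw [h]; rfl)
  have hxK : x ∈ K := hK.isCompact.isClosed.frontier_subset hx
  by_cases hpos : ∀ j, 0 ≤ x j
  · exact hposorthant x hxK hpos
  -- Zero counts as a nonnegative sign, so the all-`false` pattern means strictly negative
  -- coordinates.
  by_cases hneg : ∀ j, x j < 0
  · obtain ⟨d, hd, hdx⟩ := hposorthant (-x) (hunc.neg_mem hxK) fun j => by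
      simpa using (hneg j).le
    exact ⟨-d, neg_mem_mixedDirections hd, by simpa using hdx.neg hunc⟩
  refine ⟨orthantDirection _ fun j => decide (0 ≤ x j), mem_mixedDirections.2
    ⟨_, ⟨fun h => hpos fun j => ?_, fun h => hneg fun j => ?_⟩, rfl⟩,
    illuminates_of_mul_nonpos hcube hunc hK hxK (orthantDirection_apply_ne_zero hδ _) fun j => ?_⟩
  · simpa using congrFun h j
  · simpa using congrFun h j
  · by_cases hj : 0 ≤ x j
    · exact mul_nonpos_of_nonpos_of_nonneg
        (orthantDirection_apply_of_true hδ (by simpa using hj)).le hj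
    · exact mul_nonpos_of_nonneg_of_nonpos
        (orthantDirection_apply_of_false hδ (by simpa using hj)).le (not_le.1 hj).le

end Directions

theorem mainTheorem5 (n : ℕ) (hn : 3 ≤ n) (K : Set (EuclideanSpace ℝ (Fin n)))
    (hK : IsConvexBody K) (hunc : IsOneUnconditional K) (hcube : IsCubelike K)
    (hpar : ¬ IsParallelepiped K) :
    illuminationNumber K ≤ ((2 ^ n - 2 : ℕ) : ℕ∞) ∧
      ∃ D : Finset (EuclideanSpace ℝ (Fin n)),
        D.card = 2 ^ n - 2 ∧ (∀ d ∈ D, -d ∈ D) ∧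
          IsIlluminatingSet K (D : Set (EuclideanSpace ℝ (Fin n))) := by
  obtain ⟨δ, hδ, hill⟩ := exists_isIlluminatingSet_mixedDirections hn hK hunc hcube hpar
  have hcard := card_mixedDirections (n := n) (by omega) hδ
  refine ⟨iInf₂_le_of_le _ hill ?_, mixedDirections n δ, hcard,
    fun d => neg_mem_mixedDirections, hill⟩
  rw [Set.encard_coe_eq_coe_finsetCard, hcard]
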